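/- Let $K$ be a field of characteristic zero. All operators are $K$-linear endomorphisms of $K[x]$. Let $\mathbf x$ be multiplication by $x$, $D$ the derivative, and $E^a p(x)=p(x+a)$ for $a\in K$. An operator is shift-invariant if it commutes with every $E^a$, $a\in K$; a delta operator is a shift-invariant operator $Q$ such that $Qx$ is a nonzero constant. For a delta operator $Q$, an invertible operator $s$ is a Sheffer operator for $Q$ if $Q(sx^n)=n\,sx^{n-1}$ for all $n\ge 0$ (so $Q(s1)=0$); an Appell operator is a Sheffer operator for $D$; and $\varphi$ is the umbral operator of $Q$, written $\varphi\rightsquigarrow Q$, if $\varphi$ is a Sheffer operator for $Q$, $\varphi 1=1$, and $\varphi x^n$ vanishes at $0$ for all $n>0$. Write $\left[{n\atop k}\right]_\varphi$ for the coefficient of $x^k$ in $\varphi x^n$. For $b,c\in K$ put $$\log(1+bD)=\sum_{n\ge1}\frac{(-1)^{n+1}b^n}{n}D^n,\qquad (1+bD)^c=\sum_{n\ge0}\binom cn b^nD^n .$$ **Theorem.** Let $\varphi\rightsquigarrow Q$ for a delta operator $Q$. There exist shift-invariant operators $U,V$ such that $$\varphi\,\mathbf x^n=\sum_{k=0}^n\left[{n\atop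 k}\right]_\varphi \mathbf x^k\,U^kV^n\varphi\qquad\text{for all } n\ge 0 \tag{$*$}$$ if and only if $Q$ has one of the four forms in the first column below, for some nonzero $a,b,c\in K$. Moreover, operators $U,V$ are shift-invariant and satisfy $(*)$ if and only if $(Q,U,V)$ is given by a row of the table, for some nonzero $a,b,c\in K$ and, in the first row, some Appell operator $A$: $$\begin{array}{c|c|c} Q&U&V\\ \hline aD & A & A^{-1}\\ a(E^b-1)&1&E^{-b}\\ a\log(1+bD)&1+bD&1\\ a((1+bD)^c-1)&1+bD&(1+bD)^{-c}\end{array}$$ -/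

import Mathlib

open Polynomial

noncomputable section

namespace Umbral

variable {K : Type*} [Field K]

/-- The operator `x` of multiplication by the variable on `K[x]`. -/
def mulX : Module.End K K[X] := LinearMap.mulLeft K (X : K[X])

/-- The derivative operator `D` on `K[x]`. -/
def D : Module.End K K[X] := Polynomial.derivative

/-- The shift operator `E^a`, `p(x) ↦ p(x + a)`, on `K[x]`. -/
def shift (a : K) : Module.End K K[X] := Polynomial.taylor a

/-- `U` is shift-invariant: it commutes with every shift `E^a`. -/
def IsShiftInvariant (U : Module.End K K[X]) : Prop :=
  ∀ a : K, U * shift a = shift a * U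

/-- `Q` is a delta operator: shift-invariant, with `Q x` a nonzero constant. -/
def IsDelta (Q : Module.End K K[X]) : Prop :=
  IsShiftInvariant Q ∧ ∃ c : K, c ≠ 0 ∧ Q X = C c

/-- `s` is a Sheffer operator for the delta operator `Q`: it is invertible and
`Q sₙ = n sₙ₋₁` for all `n`, where `sₙ = s xⁿ` (for `n = 0` this reads `Q s₀ = 0`). -/
def IsSheffer (s Q : Module.End K K[X]) : Prop :=
  IsDelta Q ∧ IsUnit s ∧ ∀ n : ℕ, Q (s (X ^ n)) = n • s (X ^ (n - 1))

/-- An Appell operator is a Sheffer operator for `D`. -/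
def IsAppell (A : Module.End K K[X]) : Prop := IsSheffer A D

/-- `φ ⇝ Q`: `φ` is the umbral (basic) operator of the delta operator `Q`. -/
def IsUmbral (φ Q : Module.End K K[X]) : Prop :=
  IsSheffer φ Q ∧ φ 1 = 1 ∧ ∀ n : ℕ, 0 < n → (φ (X ^ n)).eval 0 = 0

/-- The coefficient `[n, k]_φ` of `x^k` in `φ x^n`. -/
def opCoeff (φ : Module.End K K[X]) (n k : ℕ) : K := (φ (X ^ n)).coeff k

/-- The operator `f(D) = ∑ₖ fₖ Dᵏ` for a formal power series `f`, given on monomials, where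
the terms with `k > n` vanish on `xⁿ`. -/
def seriesD (f : PowerSeries K) : Module.End K K[X] :=
  (Polynomial.basisMonomials K).constr K fun n =>
    ∑ k ∈ Finset.range (n + 1), PowerSeries.coeff k f • (D ^ k) (X ^ n : K[X])

/-- On every polynomial `f(D)` is the series `∑ₖ fₖ Dᵏ p`, truncated anywhere past `deg p`. -/
theorem seriesD_apply (f : PowerSeries K) (p : K[X]) (N : ℕ) (hN : p.natDegree < N) :
    seriesD f p = ∑ k ∈ Finset.range N, PowerSeries.coeff k f • (D ^ k) p := by
  have key : ∀ n : ℕ, n < N → seriesD f (X ^ n) =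
      ∑ k ∈ Finset.range N, PowerSeries.coeff k f • (D ^ k) (X ^ n : K[X]) := by
    intro n hn
    have h1 : seriesD f (X ^ n) =
        ∑ k ∈ Finset.range (n + 1), PowerSeries.coeff k f • (D ^ k) (X ^ n : K[X]) := by
      have := (Polynomial.basisMonomials K).constr_basis K (fun n =>
        ∑ k ∈ Finset.range (n + 1), PowerSeries.coeff k f • (D ^ k) (X ^ n : K[X])) n
      simpa only [seriesD, Polynomial.coe_basisMonomials,
        Polynomial.monomial_one_right_eq_X_pow] using this
    rw [h1]
    refine Finset.sum_subset (Finset.range_mono hn) ?_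
    intro k _ hk
    have hk' : n < k := by simpa using hk
    have : (D ^ k) (X ^ n : K[X]) = 0 := by
      rw [D, Module.End.pow_apply]
      exact Polynomial.iterate_derivative_eq_zero (by simpa using hk')
    rw [this, smul_zero]
  conv_lhs => rw [p.as_sum_range_C_mul_X_pow]
  conv_rhs => rw [p.as_sum_range_C_mul_X_pow]
  simp only [map_sum, Finset.smul_sum]
  rw [Finset.sum_comm]
  refine Finset.sum_congr rfl fun n hn => ?_
  rw [← Polynomial.smul_eq_C_mul, map_smul, key n (by simp at hn; omega), Finset.smul_sum]
  refine Finset.sum_congr rfl fun k _ => ?_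
  rw [map_smul, smul_comm]

/-- The operator `log (1 + b D) = ∑_{n ≥ 1} (-1)^(n+1) b^n D^n / n`. -/
def logOneAdd [CharZero K] (b : K) : Module.End K K[X] :=
  seriesD (PowerSeries.rescale b (PowerSeries.log K))

/-- The operator `(1 + b D)^c = ∑ₙ binom(c, n) b^n D^n`. -/
def powOneAdd [CharZero K] (b c : K) : Module.End K K[X] :=
  seriesD (PowerSeries.rescale b (PowerSeries.binomialSeries K c))

/-- The commutation identities `φ xⁿ = ∑_{k ≤ n} [n, k]_φ x^k U^k V^n φ`, for all `n`. -/
def SpecialIdentity (φ U V : Module.End K K[X]) : Prop :=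
  ∀ n : ℕ, φ * mulX ^ n =
    ∑ k ∈ Finset.range (n + 1), opCoeff φ n k • (mulX ^ k * U ^ k * V ^ n * φ)

end Umbral

end

open Umbral

/-! Shift-invariant operators are exactly the power series in `D`, and the Pincherle derivative
`[f(D), x] = f'(D)` moves every power of `x` to the left, so operator identities become identities
of series. Write `Q = q(D)` and `P = p(D)` with `p = 1/q'`. Then `φ x = x P φ`
(`IsUmbral.mul_mulX`), and cancelling the invertible `φ` turns `(*)` into `(x P)ⁿ = ∑ [n, k] xᵏ Uᵏ
Vⁿ`.

Necessity: the coefficients of `x¹` for `n = 1, 2, 3` say that `p`, `p'p` and `(p'p)'p` are constant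
multiples of `u v`, `u v²` and `u v³` (`IsUmbral.series_eqs_of_specialIdentity`). Unless `p` is
constant, which is the first row, these force `u' = b` and `u v' = μ v`. Hence `u = 1 + bt`, and `v`
is an exponential or a power of `u`; integrating `q' = 1/(p₀ u v)` gives the other rows
(`series_classification`).

Sufficiency: the same two differential equations make the span of the `xᵏ Uᵏ Vⁿ` stable under
passing from `n` to `n + 1` by right multiplication by `x P` (`exists_pow_eq_sum`). Applying both
sides to `1` identifies the coefficients. -/

noncomputable section

namespace Umbral

open scoped PowerSeries

/-! ### The algebra of power series in `D` -/

section Field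

variable {K : Type*} [Field K]

theorem pow_D_apply_eq_zero {p : K[X]} {k : ℕ} (h : p.natDegree < k) : (D ^ k) p = 0 := by
  rw [D, Module.End.pow_apply]
  exact Polynomial.iterate_derivative_eq_zero h

/-- On polynomials of degree less than `N`, `f(D)` agrees with `F(D)` for any polynomial `F` whose
coefficients below `N` are those of `f`. -/
theorem seriesD_apply_eq_aeval (f : K⟦X⟧) (F : K[X]) (p : K[X]) (N : ℕ) (hN : p.natDegree < N)
    (hF : ∀ k < N, F.coeff k = PowerSeries.coeff k f) : seriesD f p = aeval D F p := by
  have hM : F.natDegree < F.natDegree + 1 + N := by omega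
  rw [aeval_eq_sum_range' hM, seriesD_apply f p (F.natDegree + 1 + N) (by omega),
    LinearMap.sum_apply]
  refine Finset.sum_congr rfl fun k _ => ?_
  rw [LinearMap.smul_apply]
  by_cases hk : k < N
  · rw [hF k hk]
  · rw [pow_D_apply_eq_zero (by omega : p.natDegree < k), smul_zero, smul_zero]

theorem seriesD_apply_eq_aeval_trunc (f : K⟦X⟧) (p : K[X]) (N : ℕ) (hN : p.natDegree < N) :
    seriesD f p = aeval D (PowerSeries.trunc N f) p :=
  seriesD_apply_eq_aeval f _ p N hN fun k hk => by rw [PowerSeries.coeff_trunc, if_pos hk]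

theorem natDegree_aeval_D_lt (F p : K[X]) (N : ℕ) (hN : p.natDegree < N) :
    (aeval D F p).natDegree < N := by
  rw [aeval_eq_sum_range, LinearMap.sum_apply]
  refine (Polynomial.natDegree_sum_le_of_forall_le _ _ fun k _ => ?_).trans_lt hN
  rw [LinearMap.smul_apply]
  refine (natDegree_smul_le _ _).trans ?_
  rw [D, Module.End.pow_apply]
  exact (natDegree_iterate_derivative p k).trans (Nat.sub_le _ _)

/-- In degree below `N` only the series modulo `t^N` matter, so multiplicativity reduces to that of
`aeval D` on truncations. -/
theorem seriesD_mul (f g : K⟦X⟧) : seriesD (f * g) = seriesD f * seriesD g := by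
  refine LinearMap.ext fun p => ?_
  have hN : p.natDegree < p.natDegree + 1 := Nat.lt_succ_self _
  rw [Module.End.mul_apply, seriesD_apply_eq_aeval_trunc g p _ hN,
    seriesD_apply_eq_aeval_trunc f _ _ (natDegree_aeval_D_lt _ _ _ hN), ← Module.End.mul_apply,
    ← map_mul]
  refine seriesD_apply_eq_aeval _ _ _ _ hN fun k hk => ?_
  rw [Polynomial.coeff_mul, PowerSeries.coeff_mul]
  refine Finset.sum_congr rfl fun x hx => ?_
  rw [Finset.HasAntidiagonal.mem_antidiagonal] at hx
  rw [PowerSeries.coeff_trunc, if_pos (by omega), PowerSeries.coeff_trunc, if_pos (by omega)]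

/-- The map `f ↦ f(D)`, as an algebra homomorphism. -/
def seriesHom : K⟦X⟧ →ₐ[K] Module.End K K[X] :=
  AlgHom.ofLinearMap
    { toFun := seriesD
      map_add' := fun f g => LinearMap.ext fun p => by
        have hN : p.natDegree < p.natDegree + 1 := Nat.lt_succ_self _
        simp only [LinearMap.add_apply, seriesD_apply _ _ _ hN, map_add, add_smul,
          Finset.sum_add_distrib]
      map_smul' := fun c f => LinearMap.ext fun p => by
        have hN : p.natDegree < p.natDegree + 1 := Nat.lt_succ_self _
        simp only [LinearMap.smul_apply, seriesD_apply _ _ _ hN, map_smul, smul_eq_mul, mul_smul,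
          Finset.smul_sum, RingHom.id_apply] }
    (LinearMap.ext fun p => by
      refine (seriesD_apply_eq_aeval 1 1 p _ (Nat.lt_succ_self _) fun k _ => ?_).trans (by simp)
      rw [Polynomial.coeff_one, PowerSeries.coeff_one])
    seriesD_mul

theorem seriesHom_apply (f : K⟦X⟧) : seriesHom f = seriesD f := rfl

theorem seriesHom_coe (F : K[X]) : seriesHom (F : K⟦X⟧) = aeval D F :=
  LinearMap.ext fun p =>
    seriesD_apply_eq_aeval _ F p _ (Nat.lt_succ_self _) fun k _ => (Polynomial.coeff_coe F k).symm

theorem seriesHom_X : seriesHom (PowerSeries.X : K⟦X⟧) = D := by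
  rw [← Polynomial.coe_X, seriesHom_coe, aeval_X]

theorem seriesHom_C (c : K) : seriesHom (PowerSeries.C c : K⟦X⟧) = c • 1 := by
  rw [← Polynomial.coe_C, seriesHom_coe, aeval_C, Algebra.algebraMap_eq_smul_one]

theorem seriesHom_comm (f g : K⟦X⟧) : seriesHom f * seriesHom g = seriesHom g * seriesHom f := by
  rw [← map_mul, mul_comm, map_mul]

theorem seriesHom_commute_D (f : K⟦X⟧) : seriesHom f * D = D * seriesHom f := by
  rw [← seriesHom_X, seriesHom_comm]

theorem D_apply (p : K[X]) : D p = derivative p := rfl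

theorem D_X_pow (n : ℕ) : D (X ^ n : K[X]) = (n : K) • X ^ (n - 1) := by
  rw [D_apply, derivative_X_pow, smul_eq_C_mul]

theorem end_ext {U V : Module.End K K[X]} (h : ∀ n : ℕ, U (X ^ n) = V (X ^ n)) : U = V := by
  refine Polynomial.lhom_ext' fun n => LinearMap.ext_ring ?_
  simpa only [LinearMap.comp_apply, monomial_one_right_eq_X_pow] using h n

theorem mulX_apply (p : K[X]) : mulX p = X * p := rfl

theorem mulX_pow_apply (n : ℕ) (p : K[X]) : (mulX ^ n) p = X ^ n * p := by
  induction n with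
  | zero => simp
  | succ n ih => rw [pow_succ', Module.End.mul_apply, ih, mulX_apply, pow_succ', mul_assoc]

theorem eval_zero_mulX (p : K[X]) : (mulX p).eval 0 = 0 := by simp [mulX_apply]

theorem mulX_mul_left_cancel {U V : Module.End K K[X]} (h : mulX * U = mulX * V) : U = V :=
  LinearMap.ext fun p => mul_left_cancel₀ (X_ne_zero (R := K)) (LinearMap.congr_fun h p)

theorem D_mul_mulX : (D * mulX : Module.End K K[X]) = mulX * D + 1 := by
  refine LinearMap.ext fun p => ?_
  simp only [Module.End.mul_apply, LinearMap.add_apply, mulX_apply, D_apply, derivative_mul,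
    derivative_X, one_mul, Module.End.one_apply]
  ring

theorem seriesHom_one_apply (f : K⟦X⟧) : seriesHom f 1 = C (PowerSeries.constantCoeff f) := by
  rw [seriesHom_apply, seriesD_apply f 1 1 (by simp)]
  simp [smul_eq_C_mul]

theorem seriesHom_X_apply (f : K⟦X⟧) :
    seriesHom f X = C (PowerSeries.constantCoeff f) * X + C (PowerSeries.coeff 1 f) := by
  rw [seriesHom_apply, seriesD_apply f X 2 (by simp)]
  simp [Finset.sum_range_succ, smul_eq_C_mul, D]

theorem eval_zero_seriesHom_X_pow (f : K⟦X⟧) (n : ℕ) :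
    (seriesHom f (X ^ n)).eval 0 = (n.factorial : K) * PowerSeries.coeff n f := by
  rw [seriesHom_apply, seriesD_apply f (X ^ n) (n + 1) (by simp), eval_finsetSum,
    Finset.sum_range_succ, Finset.sum_eq_zero]
  · rw [D, Module.End.pow_apply, iterate_derivative_X_pow_eq_smul]
    simp [Nat.descFactorial_self, mul_comm]
  · intro k hk
    rw [Finset.mem_range] at hk
    rw [D, Module.End.pow_apply, iterate_derivative_X_pow_eq_smul]
    simp [show n - k ≠ 0 by omega]

end Field

/-! ### Shift-invariant operators as series in `D`, and the Pincherle derivative -/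

section CharZero

variable {K : Type*} [Field K] [CharZero K]

theorem eq_zero_of_D_eq_zero {r : K[X]} (h : D r = 0) (h0 : r.eval 0 = 0) : r = 0 := by
  rw [eq_C_of_natDegree_eq_zero (derivative_eq_zero.1 h)] at h0 ⊢
  rw [eval_C] at h0
  rw [h0, C_0]

/-- An operator commuting with `D` is determined by the constant terms of its values on
monomials. -/
theorem eq_seriesHom_of_commute_D {U : Module.End K K[X]} (hU : U * D = D * U) (f : K⟦X⟧)
    (hf : ∀ n : ℕ, (U (X ^ n)).eval 0 = (n.factorial : K) * PowerSeries.coeff n f) :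
    U = seriesHom f := by
  refine end_ext fun n => ?_
  rw [← sub_eq_zero, ← LinearMap.sub_apply]
  have hW : (U - seriesHom f) * D = D * (U - seriesHom f) := by
    rw [sub_mul, mul_sub, hU, seriesHom_commute_D]
  have h0 : ∀ n : ℕ, ((U - seriesHom f) (X ^ n)).eval 0 = 0 := fun n => by
    rw [LinearMap.sub_apply, eval_sub, hf, eval_zero_seriesHom_X_pow, sub_self]
  generalize U - seriesHom f = W at hW h0
  -- `D (W xⁿ) = n W xⁿ⁻¹` is zero by induction, so `W xⁿ` is a constant, and its value at `0` is
  -- zero.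
  induction n with
  | zero =>
    refine eq_zero_of_D_eq_zero ?_ (h0 0)
    rw [← Module.End.mul_apply, ← hW, Module.End.mul_apply, D_X_pow]
    simp
  | succ n ih =>
    refine eq_zero_of_D_eq_zero ?_ (h0 _)
    rw [← Module.End.mul_apply, ← hW, Module.End.mul_apply, D_X_pow, map_smul,
      Nat.add_sub_cancel, ih, smul_zero]

theorem exists_seriesHom_of_commute_D {U : Module.End K K[X]} (hU : U * D = D * U) :
    ∃ f : K⟦X⟧, U = seriesHom f := by
  refine ⟨PowerSeries.mk fun n => (n.factorial : K)⁻¹ * (U (X ^ n)).eval 0,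
    eq_seriesHom_of_commute_D hU _ fun n => ?_⟩
  rw [PowerSeries.coeff_mk, mul_inv_cancel_left₀ (Nat.cast_ne_zero.2 n.factorial_ne_zero)]

theorem shift_eq_seriesHom (a : K) :
    shift a = seriesHom (PowerSeries.rescale a (PowerSeries.exp K)) := by
  refine eq_seriesHom_of_commute_D (LinearMap.ext fun p => ?_) _ fun n => ?_
  · simp [shift, D_apply, taylor_apply, derivative_comp]
  · rw [shift, taylor_X_pow, PowerSeries.coeff_rescale, PowerSeries.coeff_exp]
    have : (n.factorial : K) ≠ 0 := Nat.cast_ne_zero.2 n.factorial_ne_zero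
    simp
    field_simp

theorem isShiftInvariant_seriesHom (f : K⟦X⟧) : IsShiftInvariant (seriesHom f) := fun a => by
  rw [shift_eq_seriesHom, seriesHom_comm]

/-- A shift-invariant operator commutes with `D`: compare the coefficients of `a` in
`U (p(x + a)) = (U p)(x + a)`. -/
theorem IsShiftInvariant.commute_D {U : Module.End K K[X]} (hU : IsShiftInvariant U) :
    U * D = D * U := by
  refine LinearMap.ext fun p => Polynomial.ext fun j => ?_
  -- Both Taylor expansions may be cut off at this `N`; the summand `2` ensures that index `1` lies
  -- in the range.
  set N := p.natDegree + (U p).natDegree + 2 with hN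
  have hs : ∀ (a : K) (r : K[X]), r.natDegree < N →
      shift a r = ∑ k ∈ Finset.range N, (a ^ k * (k.factorial : K)⁻¹) • (D ^ k) r := by
    intro a r hr
    rw [shift_eq_seriesHom, seriesHom_apply, seriesD_apply _ r N hr]
    simp [PowerSeries.coeff_rescale, PowerSeries.coeff_exp]
  -- The variable here stands for the shift `a`: two polynomials in `a` agree at every point of an
  -- infinite field, hence coefficientwise.
  have key : (∑ k ∈ Finset.range N,
        C ((k.factorial : K)⁻¹ * (U ((D ^ k) p)).coeff j) * (X : K[X]) ^ k) =
      ∑ k ∈ Finset.range N, C ((k.factorial : K)⁻¹ * ((D ^ k) (U p)).coeff j) * X ^ k := by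
    refine Polynomial.funext fun a => ?_
    have h := congrArg (fun r : K[X] => r.coeff j) (LinearMap.congr_fun (hU a) p)
    simp only [Module.End.mul_apply] at h
    rw [hs a p (by omega), hs a (U p) (by omega), map_sum, finsetSum_coeff, finsetSum_coeff] at h
    simp only [map_smul, coeff_smul, smul_eq_mul] at h
    simp only [eval_finsetSum, eval_mul, eval_C, eval_pow, eval_X]
    calc _ = _ := Finset.sum_congr rfl fun k _ => by ring
      _ = _ := h
      _ = _ := Finset.sum_congr rfl fun k _ => by ring
  have h1 := congrArg (fun r : K[X] => r.coeff 1) key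
  simp only [finsetSum_coeff, coeff_C_mul_X_pow] at h1
  rw [Finset.sum_ite_eq, Finset.sum_ite_eq, if_pos (by simp; omega), if_pos (by simp; omega)] at h1
  simpa using h1

theorem IsShiftInvariant.exists_seriesHom {U : Module.End K K[X]} (hU : IsShiftInvariant U) :
    ∃ f : K⟦X⟧, U = seriesHom f :=
  exists_seriesHom_of_commute_D hU.commute_D

/-- The normal form of an operator, with powers of `x` on the left, has a unique lowest term. -/
theorem eq_of_seriesHom_add_mulX {f g : K⟦X⟧} {W W' : Module.End K K[X]}
    (h : seriesHom f + mulX * W = seriesHom g + mulX * W') : f = g := by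
  refine PowerSeries.ext fun n => ?_
  have h1 := congrArg (fun r : K[X] => r.eval 0) (LinearMap.congr_fun h (X ^ n))
  simp only [LinearMap.add_apply, Module.End.mul_apply, eval_add, eval_zero_mulX, add_zero,
    eval_zero_seriesHom_X_pow] at h1
  exact mul_left_cancel₀ (Nat.cast_ne_zero.2 n.factorial_ne_zero) h1

theorem seriesHom_injective : Function.Injective (seriesHom : K⟦X⟧ →ₐ[K] Module.End K K[X]) :=
  fun f g h => eq_of_seriesHom_add_mulX (W := 0) (W' := 0) (by rw [h])

/-- The Pincherle derivative of `f(D)` is `f'(D)`. -/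
theorem seriesHom_mul_mulX (f : K⟦X⟧) :
    seriesHom f * mulX = mulX * seriesHom f + seriesHom (PowerSeries.derivative K f) := by
  rw [← sub_eq_iff_eq_add']
  -- The commutator `[f(D), x]` commutes with `D` because `[D, x] = 1`, so its constant terms on
  -- monomials determine it.
  refine eq_seriesHom_of_commute_D ?_ _ fun n => ?_
  · have h1 : (mulX : Module.End K K[X]) * D = D * mulX - 1 := by rw [D_mul_mulX]; abel
    rw [sub_mul, mul_sub, mul_assoc, mul_assoc, h1, mul_sub, seriesHom_commute_D, mul_one,
      ← mul_assoc, ← mul_assoc, h1, seriesHom_commute_D, sub_mul, one_mul, mul_assoc, mul_assoc]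
    abel
  · rw [LinearMap.sub_apply, Module.End.mul_apply, Module.End.mul_apply, eval_sub, eval_zero_mulX,
      mulX_apply, ← pow_succ', eval_zero_seriesHom_X_pow, PowerSeries.coeff_derivative,
      Nat.factorial_succ]
    push_cast
    ring

end CharZero

/-! ### Umbral conjugation, and the identity as a statement about `x` and `D` -/

section Umbral

variable {K : Type*} [Field K] {φ Q : Module.End K K[X]} {p q u v : K⟦X⟧}

theorem IsUmbral.constantCoeff_eq_zero (hφ : IsUmbral φ Q) (hQ : Q = seriesHom q) :
    PowerSeries.constantCoeff q = 0 := by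
  have h := hφ.1.2.2 0
  rw [pow_zero, hφ.2.1, zero_smul, hQ, seriesHom_one_apply] at h
  exact C_eq_zero.1 h

theorem IsUmbral.coeff_one_ne_zero (hφ : IsUmbral φ Q) (hQ : Q = seriesHom q) :
    PowerSeries.coeff 1 q ≠ 0 := by
  obtain ⟨c, hc, h⟩ := hφ.1.1.2
  rw [hQ, seriesHom_X_apply, hφ.constantCoeff_eq_zero hQ, C_0, zero_mul, zero_add, C_inj] at h
  rwa [h]

theorem IsSheffer.mul_eq (hφ : IsSheffer φ Q) : Q * φ = φ * D := by
  refine end_ext fun n => ?_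
  rw [Module.End.mul_apply, Module.End.mul_apply, hφ.2.2 n, D_X_pow, map_smul,
    Nat.cast_smul_eq_nsmul]

/-- Since `q = t g` with `g` invertible, `D = g⁻¹(D) q(D)`. -/
theorem D_apply_eq_zero (h0 : PowerSeries.constantCoeff q = 0) (h1 : PowerSeries.coeff 1 q ≠ 0)
    {r : K[X]} (hr : seriesHom q r = 0) : D r = 0 := by
  obtain ⟨g, rfl⟩ := PowerSeries.X_dvd_iff.2 h0
  have hg : PowerSeries.constantCoeff g ≠ 0 := by
    rwa [← zero_add 1, PowerSeries.coeff_succ_X_mul, PowerSeries.coeff_zero_eq_constantCoeff] at h1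
  have h : (PowerSeries.X : K⟦X⟧) = g⁻¹ * (PowerSeries.X * g) := by
    rw [mul_comm PowerSeries.X, ← mul_assoc, PowerSeries.inv_mul_cancel g hg, one_mul]
  rw [← seriesHom_X, h, map_mul, Module.End.mul_apply, hr, map_zero]

theorem mul_mulX_pow (hx : φ * mulX = mulX * seriesHom p * φ) (n : ℕ) :
    φ * mulX ^ n = (mulX * seriesHom p) ^ n * φ :=
  SemiconjBy.pow_right (show SemiconjBy φ mulX (mulX * seriesHom p) from hx) n

theorem IsUmbral.apply_X_pow (hφ : IsUmbral φ Q) (hx : φ * mulX = mulX * seriesHom p * φ)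
    (n : ℕ) : φ (X ^ n) = ((mulX * seriesHom p) ^ n : Module.End K K[X]) 1 := by
  have h := LinearMap.congr_fun (mul_mulX_pow hx n) 1
  rwa [Module.End.mul_apply, Module.End.mul_apply, mulX_pow_apply, mul_one, hφ.2.1] at h

theorem IsUmbral.specialIdentity_iff (hφ : IsUmbral φ Q)
    (hx : φ * mulX = mulX * seriesHom p * φ) {U V : Module.End K K[X]} :
    SpecialIdentity φ U V ↔ ∀ n : ℕ, (mulX * seriesHom p) ^ n =
      ∑ k ∈ Finset.range (n + 1), opCoeff φ n k • (mulX ^ k * U ^ k * V ^ n) := by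
  refine forall_congr' fun n => ?_
  simp only [mul_mulX_pow hx, ← smul_mul_assoc, ← Finset.sum_mul]
  exact hφ.1.2.1.mul_left_inj

/-- The extra factor `u` avoids the exponent `k - 1`. -/
theorem derivative_pow_mul_self (u : K⟦X⟧) (k : ℕ) :
    PowerSeries.derivative K (u ^ k) * u = (k : K⟦X⟧) * u ^ k * PowerSeries.derivative K u := by
  rw [PowerSeries.derivative_pow]
  cases k with
  | zero => simp
  | succ k => rw [Nat.add_sub_cancel, pow_succ]; ring

/-- When `P` is the scalar `α`, `φ xⁿ = αⁿ xⁿ`: only the term `k = n` survives, and there `Uⁿ Vⁿ =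
1`. -/
theorem IsUmbral.specialIdentity_of_mul_eq_one (hφ : IsUmbral φ Q) {α : K}
    (hx : φ * mulX = mulX * seriesHom (PowerSeries.C α) * φ) (huv : u * v = 1) :
    SpecialIdentity φ (seriesHom u) (seriesHom v) := by
  rw [hφ.specialIdentity_iff hx]
  have hpow : ∀ n : ℕ, (mulX * seriesHom (PowerSeries.C α) : Module.End K K[X]) ^ n =
      α ^ n • (mulX ^ n : Module.End K K[X]) := fun n => by
    rw [seriesHom_C, mul_smul_comm, mul_one, _root_.smul_pow]
  intro n
  have hcoeff : ∀ k : ℕ, opCoeff φ n k = if k = n then α ^ n else 0 := fun k => by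
    rw [opCoeff, hφ.apply_X_pow hx, hpow]
    simp [mulX_pow_apply, coeff_X_pow]
  rw [hpow, Finset.sum_eq_single n]
  · rw [hcoeff, if_pos rfl, mul_assoc, ← map_pow, ← map_pow, ← map_mul, ← mul_pow, huv, one_pow,
      map_one, mul_one]
  · intro k _ hk
    rw [hcoeff, if_neg hk, zero_smul]
  · simp

variable [CharZero K]

/-- The umbral conjugate of multiplication by `x` is `x Q'⁻¹`. -/
theorem IsUmbral.mul_mulX (hφ : IsUmbral φ Q) (hQ : Q = seriesHom q)
    (hp : p * PowerSeries.derivative K q = 1) :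
    φ * mulX = mulX * seriesHom p * φ := by
  rw [← sub_eq_zero]
  -- The difference `R` of the two sides satisfies `Q R = R D`, because `[Q, x P] = Q' P = 1`
  -- mirrors `[D, x] = 1`. As `R xⁿ` also vanishes at `0`, induction on `n` gives `R = 0`.
  have hc : seriesHom q * (φ * mulX - mulX * seriesHom p * φ) =
      (φ * mulX - mulX * seriesHom p * φ) * D := by
    have h1 : seriesHom q * φ = φ * D := hQ ▸ hφ.1.mul_eq
    have h2 : seriesHom (PowerSeries.derivative K q) * seriesHom p = 1 := by
      rw [← map_mul, mul_comm, hp, map_one]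
    rw [mul_sub, sub_mul, ← mul_assoc, h1, mul_assoc φ, D_mul_mulX, mul_add, mul_one, ← mul_assoc,
      ← mul_assoc, ← mul_assoc (seriesHom q), seriesHom_mul_mulX, add_mul, add_mul, h2, one_mul, mul_assoc mulX,
      seriesHom_comm, mul_assoc mulX, mul_assoc (seriesHom p), h1]
    simp only [mul_assoc]
    abel
  have h0 : ∀ n : ℕ, ((φ * mulX - mulX * seriesHom p * φ : Module.End K K[X]) (X ^ n)).eval 0 = 0 := fun n => by
    rw [LinearMap.sub_apply, eval_sub, mul_assoc mulX, Module.End.mul_apply, Module.End.mul_apply,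
      eval_zero_mulX, mulX_apply, ← pow_succ', hφ.2.2 _ n.succ_pos, sub_zero]
  generalize φ * mulX - mulX * seriesHom p * φ = R at hc h0
  have hD : ∀ r : K[X], seriesHom q r = 0 → D r = 0 := fun r =>
    D_apply_eq_zero (hφ.constantCoeff_eq_zero hQ) (hφ.coeff_one_ne_zero hQ)
  refine end_ext fun n => ?_
  rw [LinearMap.zero_apply]
  induction n with
  | zero =>
    refine eq_zero_of_D_eq_zero (hD _ ?_) (h0 0)
    rw [← Module.End.mul_apply, hc, Module.End.mul_apply, D_X_pow]
    simp
  | succ n ih =>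
    refine eq_zero_of_D_eq_zero (hD _ ?_) (h0 _)
    rw [← Module.End.mul_apply, hc, Module.End.mul_apply, D_X_pow, map_smul,
      Nat.add_sub_cancel, ih, smul_zero]

/-- Comparing the lowest coefficients of the two sides of the identity for `n = m + 1`. -/
theorem IsUmbral.lowest_coeff_eq (hφ : IsUmbral φ Q) (hx : φ * mulX = mulX * seriesHom p * φ)
    (h : SpecialIdentity φ (seriesHom u) (seriesHom v)) {m : ℕ} {f : K⟦X⟧} {W : Module.End K K[X]}
    (hf : (mulX * seriesHom p) ^ (m + 1) = mulX * (seriesHom f + mulX * W)) :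
    f = PowerSeries.C (PowerSeries.constantCoeff f) * u * v ^ (m + 1) := by
  have h0 : opCoeff φ (m + 1) 0 = 0 := by
    rw [opCoeff, coeff_zero_eq_eval_zero, hφ.2.2 _ m.succ_pos]
  have h1 : opCoeff φ (m + 1) 1 = PowerSeries.constantCoeff f := by
    rw [opCoeff, hφ.apply_X_pow hx, hf]
    simp [mulX_apply, seriesHom_one_apply, coeff_X_mul, coeff_zero_eq_eval_zero]
  have h2 := (hφ.specialIdentity_iff hx).1 h (m + 1)
  rw [Finset.sum_range_succ', Finset.sum_range_succ', h0, zero_smul, add_zero, zero_add, h1, hf,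
    add_comm (Finset.sum _ _)] at h2
  -- One factor `x` is cancelled from both sides; `W'` collects the terms with `k ≥ 2`, which still
  -- carry another.
  refine eq_of_seriesHom_add_mulX (W := W) (W' := ∑ k ∈ Finset.range m,
    opCoeff φ (m + 1) (k + 1 + 1) • (mulX ^ k * seriesHom u ^ (k + 1 + 1) * seriesHom v ^ (m + 1)))
    (mulX_mul_left_cancel (h2.trans ?_))
  rw [mul_add, Finset.mul_sum, Finset.mul_sum, map_mul, map_mul, map_pow, seriesHom_C]
  congr 1
  · simp [mul_assoc]
  · refine Finset.sum_congr rfl fun k _ => ?_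
    rw [mul_smul_comm, mul_smul_comm, pow_succ' mulX, pow_succ' mulX]
    simp only [mul_assoc]

/-- The coefficient of `x` in the normal form of `(x P)ⁿ` is `p`, `p'p`, `(p'p)'p` for `n = 1, 2,
3`. The classification uses the values of the first two constants, but only the existence of the
third. -/
theorem IsUmbral.series_eqs_of_specialIdentity (hφ : IsUmbral φ Q)
    (hx : φ * mulX = mulX * seriesHom p * φ)
    (h : SpecialIdentity φ (seriesHom u) (seriesHom v)) :
    (∃ c : K, c = PowerSeries.constantCoeff p ∧ p = PowerSeries.C c * u * v) ∧
    (∃ c : K, c = PowerSeries.constantCoeff p * PowerSeries.coeff 1 p ∧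
      PowerSeries.derivative K p * p = PowerSeries.C c * u * v ^ 2) ∧
    ∃ c : K, PowerSeries.derivative K (PowerSeries.derivative K p) * p * p +
      PowerSeries.derivative K p ^ 2 * p = PowerSeries.C c * u * v ^ 3 := by
  refine ⟨⟨_, rfl, ?_⟩, ⟨_, rfl, ?_⟩, ⟨_, hφ.lowest_coeff_eq hx h (m := 2)
    (W := seriesHom p * mulX * seriesHom p * seriesHom p + seriesHom p *
      seriesHom (PowerSeries.derivative K p) * seriesHom p
      + seriesHom (PowerSeries.derivative K p) * seriesHom p * seriesHom p) ?_⟩⟩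
  · simpa using hφ.lowest_coeff_eq hx h (m := 0) (f := p) (W := 0) (by simp)
  · have h2 := hφ.lowest_coeff_eq hx h (m := 1) (f := PowerSeries.derivative K p * p)
      (W := seriesHom p * seriesHom p) (by
        rw [pow_succ, pow_one, mul_assoc, ← mul_assoc (seriesHom p), seriesHom_mul_mulX, add_mul,
          map_mul, mul_assoc, add_comm])
    have hc : PowerSeries.constantCoeff (PowerSeries.derivative K p) = PowerSeries.coeff 1 p := by
      rw [← PowerSeries.coeff_zero_eq_constantCoeff_apply, PowerSeries.coeff_derivative]
      simp
    rwa [map_mul PowerSeries.constantCoeff, hc, mul_comm (PowerSeries.coeff 1 p)] at h2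
  · have h3 : (mulX * seriesHom p) ^ 3 =
        mulX * (seriesHom p * mulX * (seriesHom p * mulX) * seriesHom p) := by
      simp only [pow_succ, pow_zero, one_mul, mul_assoc]
    have h4 := seriesHom_mul_mulX (PowerSeries.derivative K p)
    rw [h3]
    congr 1
    calc _ = mulX * seriesHom p * (seriesHom p * mulX) * seriesHom p +
          seriesHom (PowerSeries.derivative K p) * (seriesHom p * mulX) * seriesHom p := by
          rw [seriesHom_mul_mulX, ← seriesHom_mul_mulX]
          nth_rw 1 [seriesHom_mul_mulX]
          rw [add_mul, add_mul]
      _ = mulX * seriesHom p * (mulX * seriesHom p + seriesHom (PowerSeries.derivative K p)) *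
            seriesHom p +
          (seriesHom (PowerSeries.derivative K p) * mulX) * seriesHom p * seriesHom p
          + seriesHom (PowerSeries.derivative K p) * seriesHom (PowerSeries.derivative K p) *
            seriesHom p := by
          rw [seriesHom_mul_mulX p]
          simp only [mul_add, add_mul, mul_assoc]
          abel
      _ = _ := by
          rw [h4]
          simp only [mul_add, add_mul, mul_assoc, map_add, map_mul, pow_two]
          abel

/-- If `P = α U V` with `U' = b` and `U V' = μ V`, then `(x P)ⁿ` is a combination of the operators
`xᵏ Uᵏ Vⁿ`. -/
theorem exists_pow_eq_sum {α b μ : K} (hp : p = PowerSeries.C α * u * v)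
    (hu : PowerSeries.derivative K u = PowerSeries.C b)
    (hv : u * PowerSeries.derivative K v = PowerSeries.C μ * v) (n : ℕ) :
    ∃ c : ℕ → K, (∀ k, n < k → c k = 0) ∧ (mulX * seriesHom p) ^ n =
      ∑ k ∈ Finset.range (n + 1), c k • (mulX ^ k * seriesHom (u ^ k * v ^ n)) := by
  induction n with
  | zero =>
    exact ⟨fun k => if k = 0 then 1 else 0, fun k hk => if_neg (by omega), by simp⟩
  | succ n ih =>
    obtain ⟨c, hc, h⟩ := ih
    -- With `F = uᵏ vⁿ`, the Pincherle rule gives `F x P = x F P + F' P`; the equations for `u'` and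
    -- `v'` make `F' P` a multiple of `uᵏ vⁿ⁺¹`.
    have step : ∀ k : ℕ, mulX ^ k * seriesHom (u ^ k * v ^ n) * (mulX * seriesHom p) =
        α • (mulX ^ (k + 1) * seriesHom (u ^ (k + 1) * v ^ (n + 1))) +
        (α * (k * b + n * μ)) • (mulX ^ k * seriesHom (u ^ k * v ^ (n + 1))) := by
      intro k
      have h1 : u ^ k * v ^ n * p = α • (u ^ (k + 1) * v ^ (n + 1)) := by
        rw [hp, PowerSeries.smul_eq_C_mul]; ring
      have h2 : PowerSeries.derivative K (u ^ k * v ^ n) * p =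
          (α * (k * b + n * μ)) • (u ^ k * v ^ (n + 1)) := by
        have e1 := derivative_pow_mul_self u k
        have e2 := derivative_pow_mul_self v n
        rw [hu] at e1
        rw [hp, PowerSeries.smul_eq_C_mul, Derivation.leibniz, smul_eq_mul, smul_eq_mul]
        simp only [map_mul, map_add, map_natCast]
        linear_combination (PowerSeries.C α * v ^ n * v) * e1 + (PowerSeries.C α * u ^ k * u) * e2 +
          (PowerSeries.C α * u ^ k * n * v ^ n) * hv
      rw [mul_assoc, ← mul_assoc (seriesHom (u ^ k * v ^ n)), seriesHom_mul_mulX, add_mul, mul_add,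
        mul_assoc mulX, ← map_mul, ← map_mul, h1, h2, ← mul_assoc, ← pow_succ, map_smul, map_smul,
        mul_smul_comm, mul_smul_comm]
    -- The recurrence read off from `step`. Vanishing of `c` beyond `n` lets the second sum be
    -- extended to `k = n + 1`.
    refine ⟨fun k => (if k = 0 then 0 else α * c (k - 1)) + α * (k * b + n * μ) * c k,
      fun k hk => ?_, ?_⟩
    · simp only
      rw [hc k (by omega), hc (k - 1) (by omega)]
      simp
    · rw [pow_succ, h, Finset.sum_mul]
      simp only [smul_mul_assoc, step, add_smul, smul_add, Finset.sum_add_distrib]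
      congr 1
      · rw [Finset.sum_range_succ' _ (n + 1)]
        simp [smul_smul, mul_comm]
      · rw [Finset.sum_range_succ _ (n + 1), hc (n + 1) (by omega)]
        simp [smul_smul, mul_comm, mul_left_comm]

/-- Since `u` and `v` have constant term `1`, `xᵏ Uᵏ Vⁿ` sends `1` to `xᵏ`. Hence any coefficients
expressing `(x P)ⁿ` in these operators are those of `φ xⁿ`. -/
theorem IsUmbral.specialIdentity_of_series_eqs (hφ : IsUmbral φ Q)
    (hx : φ * mulX = mulX * seriesHom p * φ) {α b μ : K} (hp : p = PowerSeries.C α * u * v)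
    (hu : PowerSeries.derivative K u = PowerSeries.C b)
    (hv : u * PowerSeries.derivative K v = PowerSeries.C μ * v)
    (hu0 : PowerSeries.constantCoeff u = 1) (hv0 : PowerSeries.constantCoeff v = 1) :
    SpecialIdentity φ (seriesHom u) (seriesHom v) := by
  rw [hφ.specialIdentity_iff hx]
  intro n
  obtain ⟨c, hc, h⟩ := exists_pow_eq_sum hp hu hv n
  have hcoeff : ∀ k ∈ Finset.range (n + 1), opCoeff φ n k = c k := by
    intro k hk
    have hterm : ∀ j : ℕ, ((c j • (mulX ^ j * seriesHom (u ^ j * v ^ n)) : Module.End K K[X])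
        1).coeff k = if k = j then c j else 0 := fun j => by
      rw [LinearMap.smul_apply, Module.End.mul_apply, mulX_pow_apply, seriesHom_one_apply, map_mul,
        map_pow, map_pow, hu0, hv0]
      simp [coeff_X_pow]
    rw [opCoeff, hφ.apply_X_pow hx, h, LinearMap.sum_apply, finsetSum_coeff]
    simp only [hterm]
    rw [Finset.sum_ite_eq, if_pos hk]
  rw [h]
  refine Finset.sum_congr rfl fun k hk => ?_
  rw [hcoeff k hk, map_mul, map_pow, map_pow, mul_assoc]

end Umbral

/-! ### Differential equations for power series, and the classification -/

section Series

variable {K : Type*} [Field K]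

theorem derivative_rescale (b : K) (f : K⟦X⟧) :
    PowerSeries.derivative K (PowerSeries.rescale b f) =
      PowerSeries.C b * PowerSeries.rescale b (PowerSeries.derivative K f) := by
  ext n
  rw [PowerSeries.coeff_derivative, PowerSeries.coeff_rescale, PowerSeries.coeff_C_mul,
    PowerSeries.coeff_rescale, PowerSeries.coeff_derivative]
  ring

theorem constantCoeff_rescale (b : K) (f : K⟦X⟧) :
    PowerSeries.constantCoeff (PowerSeries.rescale b f) = PowerSeries.constantCoeff f := by
  rw [← PowerSeries.coeff_zero_eq_constantCoeff_apply, PowerSeries.coeff_rescale, pow_zero, one_mul,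
    PowerSeries.coeff_zero_eq_constantCoeff_apply]

theorem derivative_C_mul (c : K) (f : K⟦X⟧) :
    PowerSeries.derivative K (PowerSeries.C c * f) =
      PowerSeries.C c * PowerSeries.derivative K f := by
  rw [← PowerSeries.smul_eq_C_mul, Derivation.map_smul, PowerSeries.smul_eq_C_mul]

theorem derivative_mul (f g : K⟦X⟧) :
    PowerSeries.derivative K (f * g) =
      f * PowerSeries.derivative K g + PowerSeries.derivative K f * g := by
  rw [Derivation.leibniz, smul_eq_mul, smul_eq_mul, mul_comm g]

theorem rescale_X (b : K) : PowerSeries.rescale b (PowerSeries.X : K⟦X⟧) =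
    PowerSeries.C b * PowerSeries.X := by
  ext n
  rw [PowerSeries.coeff_rescale, PowerSeries.coeff_C_mul, PowerSeries.coeff_X]
  split_ifs with h
  · rw [h, pow_one]
  · simp

theorem constantCoeff_one_add (b : K) :
    PowerSeries.constantCoeff (1 + PowerSeries.C b * PowerSeries.X : K⟦X⟧) = 1 := by simp

theorem derivative_one_add (b : K) :
    PowerSeries.derivative K (1 + PowerSeries.C b * PowerSeries.X : K⟦X⟧) = PowerSeries.C b := by
  rw [map_add, derivative_C_mul, PowerSeries.derivative_X, mul_one, ← map_one PowerSeries.C,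
    PowerSeries.derivative_C, zero_add]

variable [CharZero K]

theorem series_ext {f g : K⟦X⟧}
    (hD : PowerSeries.derivative K f = PowerSeries.derivative K g)
    (hc : PowerSeries.constantCoeff f = PowerSeries.constantCoeff g) : f = g :=
  PowerSeries.derivative.ext hD hc

/-- The series of `exp (b t)`. -/
def expSeries (b : K) : K⟦X⟧ := PowerSeries.rescale b (PowerSeries.exp K)

/-- The series of `(1 + b t) ^ c`. -/
def powSeries (b c : K) : K⟦X⟧ := PowerSeries.rescale b (PowerSeries.binomialSeries K c)

/-- The series of `log (1 + b t)`. -/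
def logSeries (b : K) : K⟦X⟧ := PowerSeries.rescale b (PowerSeries.log K)

theorem constantCoeff_expSeries (b : K) : PowerSeries.constantCoeff (expSeries b) = 1 := by
  rw [expSeries, constantCoeff_rescale, PowerSeries.constantCoeff_exp]

theorem constantCoeff_powSeries (b c : K) : PowerSeries.constantCoeff (powSeries b c) = 1 := by
  rw [powSeries, constantCoeff_rescale, PowerSeries.binomialSeries_constantCoeff]

theorem constantCoeff_logSeries (b : K) : PowerSeries.constantCoeff (logSeries b) = 0 := by
  rw [logSeries, constantCoeff_rescale, PowerSeries.constantCoeff_log]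

theorem derivative_expSeries (b : K) :
    PowerSeries.derivative K (expSeries b) = PowerSeries.C b * expSeries b := by
  rw [expSeries, derivative_rescale, PowerSeries.derivative_exp]

theorem expSeries_mul_neg (b : K) : expSeries b * expSeries (-b) = 1 := by
  refine series_ext ?_ ?_
  · rw [derivative_mul, derivative_expSeries, derivative_expSeries, PowerSeries.derivative_one,
      map_neg]
    ring
  · rw [map_mul, constantCoeff_expSeries, constantCoeff_expSeries, map_one, one_mul]

theorem one_add_mul_derivative_logSeries (b : K) :
    (1 + PowerSeries.C b * PowerSeries.X) * PowerSeries.derivative K (logSeries b) =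
      PowerSeries.C b := by
  have h : (1 + PowerSeries.X) * PowerSeries.derivative K (PowerSeries.log K) = 1 := by
    ext n
    rw [add_mul, one_mul, map_add, PowerSeries.deriv_log]
    cases n with
    | zero => simp
    | succ n =>
      rw [PowerSeries.coeff_succ_X_mul, PowerSeries.coeff_mk, PowerSeries.coeff_mk,
        PowerSeries.coeff_one]
      simp [pow_succ]
  rw [logSeries, derivative_rescale, ← rescale_X, ← map_one (PowerSeries.rescale b), ← map_add,
    mul_left_comm, ← map_mul, h, map_one, mul_one]

theorem succ_mul_choose (c : K) (n : ℕ) :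
    ((n : K) + 1) * Ring.choose c (n + 1) = (c - n) * Ring.choose c n := by
  have h := Ring.choose_smul_choose c n.le_succ
  rw [Nat.choose_succ_self_right, Nat.succ_sub (le_refl n), Nat.sub_self, Ring.choose_one_right,
    nsmul_eq_mul] at h
  push_cast at h
  rw [h, mul_comm]

theorem one_add_mul_derivative_powSeries (b c : K) :
    (1 + PowerSeries.C b * PowerSeries.X) * PowerSeries.derivative K (powSeries b c) =
      PowerSeries.C (b * c) * powSeries b c := by
  have h : (1 + PowerSeries.X) * PowerSeries.derivative K (PowerSeries.binomialSeries K c) =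
      PowerSeries.C c * PowerSeries.binomialSeries K c := by
    ext n
    rw [add_mul, one_mul, map_add, PowerSeries.coeff_C_mul, PowerSeries.binomialSeries_coeff,
      PowerSeries.coeff_derivative, PowerSeries.binomialSeries_coeff]
    have h1 := succ_mul_choose c n
    cases n with
    | zero => simp
    | succ n =>
      rw [PowerSeries.coeff_succ_X_mul, PowerSeries.coeff_derivative,
        PowerSeries.binomialSeries_coeff, smul_eq_mul, smul_eq_mul]
      push_cast at h1 ⊢
      linear_combination h1
  have hC : PowerSeries.rescale b (PowerSeries.C c) = PowerSeries.C c := by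
    ext n
    rw [PowerSeries.coeff_rescale, PowerSeries.coeff_C]
    split_ifs with hn
    · rw [hn, pow_zero, one_mul]
    · rw [mul_zero]
  rw [powSeries, derivative_rescale, ← rescale_X, ← map_one (PowerSeries.rescale b), ← map_add,
    mul_left_comm, ← map_mul, h, map_mul, map_mul, ← mul_assoc,
    hC]

theorem powSeries_mul_neg (b c : K) : powSeries b c * powSeries b (-c) = 1 := by
  rw [powSeries, powSeries, ← map_mul, ← PowerSeries.binomialSeries_add, add_neg_cancel,
    PowerSeries.binomialSeries_zero, map_one]

/-- Two solutions of `w f' = μ f` with the same constant term agree. -/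
theorem eq_of_mul_derivative_eq {w f g g' : K⟦X⟧} {μ : K} (hw : w ≠ 0) (hgg : g * g' = 1)
    (hf : w * PowerSeries.derivative K f = PowerSeries.C μ * f)
    (hg : w * PowerSeries.derivative K g' = -(PowerSeries.C μ * g'))
    (h0 : PowerSeries.constantCoeff f = PowerSeries.constantCoeff g) : f = g := by
  -- Here `g'` denotes the inverse of `g`, not its derivative; the two equations make `w (f g')'`
  -- vanish.
  have h : f * g' = 1 := by
    refine series_ext (mul_left_cancel₀ hw ?_) ?_
    · rw [derivative_mul, PowerSeries.derivative_one]
      linear_combination f * hg + g' * hf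
    · rw [map_mul, h0, ← map_mul, hgg]
  calc f = f * (g * g') := by rw [hgg, mul_one]
    _ = (f * g') * g := by ring
    _ = g := by rw [h, one_mul]

/-- The power series form of the classification. -/
theorem series_classification {p q u v : K⟦X⟧} (hq0 : PowerSeries.constantCoeff q = 0)
    (hp : p * PowerSeries.derivative K q = 1)
    (h1 : ∃ c : K, c = PowerSeries.constantCoeff p ∧ p = PowerSeries.C c * u * v)
    (h2 : ∃ c : K, c = PowerSeries.constantCoeff p * PowerSeries.coeff 1 p ∧
      PowerSeries.derivative K p * p = PowerSeries.C c * u * v ^ 2)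
    (h3 : ∃ c : K, PowerSeries.derivative K (PowerSeries.derivative K p) * p * p +
      PowerSeries.derivative K p ^ 2 * p = PowerSeries.C c * u * v ^ 3) :
    (∃ a : K, a ≠ 0 ∧ q = a • PowerSeries.X ∧ u * v = 1) ∨
    (∃ a b : K, a ≠ 0 ∧ b ≠ 0 ∧ q = a • (expSeries b - 1) ∧ u = 1 ∧ v = expSeries (-b)) ∨
    (∃ a b : K, a ≠ 0 ∧ b ≠ 0 ∧ q = a • logSeries b ∧
      u = 1 + PowerSeries.C b * PowerSeries.X ∧ v = 1) ∨
    (∃ a b c : K, a ≠ 0 ∧ b ≠ 0 ∧ c ≠ 0 ∧ q = a • (powSeries b c - 1) ∧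
      u = 1 + PowerSeries.C b * PowerSeries.X ∧ v = powSeries b (-c)) := by
  obtain ⟨p0, hp0, h1⟩ := h1
  obtain ⟨c2, hc2, h2⟩ := h2
  obtain ⟨l, h3⟩ := h3
  rw [← hp0] at hc2
  have hpne : p ≠ 0 := left_ne_zero_of_mul (hp.trans_ne one_ne_zero)
  have hune : u ≠ 0 := fun h => hpne (by rw [h1, h, mul_zero, zero_mul])
  have hvne : v ≠ 0 := fun h => hpne (by rw [h1, h, mul_zero])
  have hp0ne : p0 ≠ 0 := by
    have h := congrArg PowerSeries.constantCoeff hp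
    rw [map_mul, ← hp0, map_one] at h
    exact left_ne_zero_of_mul (h.trans_ne one_ne_zero)
  have hCne : (PowerSeries.C p0 : K⟦X⟧) ≠ 0 := fun h =>
    hp0ne (PowerSeries.C_injective (h.trans (map_zero _).symm))
  obtain ⟨p1, hp1⟩ : ∃ p1, p1 = PowerSeries.coeff 1 p := ⟨_, rfl⟩
  rw [← hp1] at hc2
  have hinv : (PowerSeries.C p0⁻¹ * PowerSeries.C p0 : K⟦X⟧) = 1 := by
    rw [← map_mul, inv_mul_cancel₀ hp0ne, map_one]
  have huv0 : PowerSeries.constantCoeff u * PowerSeries.constantCoeff v = 1 := by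
    have h := congrArg PowerSeries.constantCoeff h1
    rw [← hp0, map_mul, map_mul, PowerSeries.constantCoeff_C, mul_assoc] at h
    exact mul_left_cancel₀ hp0ne (by rw [← h, mul_one])
  -- Quotient of the second equation by the first.
  have hp' : PowerSeries.derivative K p = PowerSeries.C p1 * v := by
    refine mul_right_cancel₀ hpne (h2.trans ?_)
    rw [hc2, map_mul]
    linear_combination (-(PowerSeries.C p1 * v)) * h1
  by_cases hp1z : p1 = 0
  · left
    have hpC : p = PowerSeries.C p0 := by
      refine series_ext ?_ ?_
      · rw [hp', hp1z, map_zero, zero_mul, PowerSeries.derivative_C]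
      · rw [← hp0, PowerSeries.constantCoeff_C]
    refine ⟨p0⁻¹, inv_ne_zero hp0ne, ?_, ?_⟩
    · refine series_ext ?_ ?_
      · rw [Derivation.map_smul, PowerSeries.derivative_X, PowerSeries.smul_eq_C_mul]
        rw [hpC] at hp
        linear_combination PowerSeries.C p0⁻¹ * hp - PowerSeries.derivative K q * hinv
      · rw [hq0, PowerSeries.smul_eq_C_mul]; simp
    · refine mul_left_cancel₀ hCne ?_
      rw [mul_one, ← mul_assoc, ← h1, hpC]
  right
  have hC1ne : (PowerSeries.C p1 : K⟦X⟧) ≠ 0 := fun h =>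
    hp1z (PowerSeries.C_injective (h.trans (map_zero _).symm))
  have hv0 : PowerSeries.constantCoeff v = 1 := by
    have h := congrArg PowerSeries.constantCoeff hp'
    rw [← PowerSeries.coeff_zero_eq_constantCoeff_apply, PowerSeries.coeff_derivative, zero_add,
      ← hp1, map_mul, PowerSeries.constantCoeff_C] at h
    exact mul_left_cancel₀ hp1z (by rw [← h]; simp)
  have hu0 : PowerSeries.constantCoeff u = 1 := by rwa [hv0, mul_one] at huv0
  obtain ⟨μ, hμ⟩ : ∃ μ : K, u * PowerSeries.derivative K v = PowerSeries.C μ * v := by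
    -- With `p' = p₁ v`, dividing the third equation by `p = p₀ u v` leaves `p₀ p₁ u v v' + p₁² v² =
    -- (l/p₀) v²`.
    refine ⟨(l / p0 - p1 ^ 2) / (p0 * p1), ?_⟩
    refine mul_left_cancel₀ (mul_ne_zero hCne hC1ne) (mul_right_cancel₀ hvne ?_)
    rw [← mul_assoc _ (PowerSeries.C ((l / p0 - p1 ^ 2) / (p0 * p1))), ← map_mul, ← map_mul,
      mul_div_cancel₀ _ (mul_ne_zero hp0ne hp1z)]
    rw [hp', derivative_C_mul] at h3
    refine mul_right_cancel₀ hpne ?_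
    have hl : (PowerSeries.C l : K⟦X⟧) = PowerSeries.C p0 * PowerSeries.C (l / p0) := by
      rw [← map_mul, mul_div_cancel₀ _ hp0ne]
    rw [hl] at h3
    simp only [map_mul, map_sub, map_pow]
    linear_combination h3 + (-PowerSeries.C (l / p0) * v ^ 2 -
      PowerSeries.C p1 * PowerSeries.derivative K v * p) * h1
  -- Differentiating `p = p₀ u v` gives `p₁ v = p₀ (u' v + μ v)`.
  have hu' : PowerSeries.derivative K u = PowerSeries.C (p1 / p0 - μ) := by
    have h := congrArg (PowerSeries.derivative K) h1
    rw [hp', derivative_mul, derivative_C_mul] at h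
    refine mul_right_cancel₀ hvne (mul_left_cancel₀ hCne ?_)
    have hm : (PowerSeries.C p1 : K⟦X⟧) = PowerSeries.C p0 * PowerSeries.C (p1 / p0) := by
      rw [← map_mul, mul_div_cancel₀ _ hp0ne]
    rw [hm] at h
    rw [map_sub]
    linear_combination -h - PowerSeries.C p0 * hμ
  have hμb : μ = p1 / p0 - (p1 / p0 - μ) := by ring
  generalize p1 / p0 - μ = b at hu' hμb
  have hu : u = 1 + PowerSeries.C b * PowerSeries.X := by
    refine series_ext ?_ ?_
    · rw [hu', derivative_one_add]
    · rw [hu0, constantCoeff_one_add]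
  have hq' : PowerSeries.C p0 * (u * v * PowerSeries.derivative K q) = 1 := by
    rw [h1] at hp
    linear_combination hp
  have hq'' : u * v * PowerSeries.derivative K q = PowerSeries.C p0⁻¹ := by
    linear_combination PowerSeries.C p0⁻¹ * hq' - u * v * PowerSeries.derivative K q * hinv
  by_cases hb : b = 0
  · left
    rw [hb, map_zero, zero_mul, add_zero] at hu
    have hμ0 : μ ≠ 0 := by
      rw [hμb, hb, sub_zero]
      exact div_ne_zero hp1z hp0ne
    have hv : v = expSeries μ := by
      rw [hu] at hμ
      refine eq_of_mul_derivative_eq one_ne_zero (expSeries_mul_neg μ) hμ ?_ ?_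
      · rw [derivative_expSeries, map_neg]; ring
      · rw [hv0, constantCoeff_expSeries]
    -- Here `q' = p₀⁻¹ exp(-μt)`, so the parameter `b` of the table is `-μ`.
    refine ⟨-(p0⁻¹ / μ), -μ, neg_ne_zero.2 (div_ne_zero (inv_ne_zero hp0ne) hμ0),
      neg_ne_zero.2 hμ0, ?_, hu, by rw [neg_neg, hv]⟩
    refine series_ext (mul_left_cancel₀ (mul_ne_zero hune hvne) ?_) ?_
    · rw [hq'', Derivation.map_smul, map_sub, derivative_expSeries, PowerSeries.derivative_one, sub_zero, hu,
        hv, PowerSeries.smul_eq_C_mul, one_mul]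
      have e : (PowerSeries.C p0⁻¹ : K⟦X⟧) =
          PowerSeries.C (-(p0⁻¹ / μ)) * PowerSeries.C (-μ) := by
        rw [← map_mul, neg_mul_neg, div_mul_cancel₀ _ hμ0]
      rw [e]
      linear_combination
        (-PowerSeries.C (-(p0⁻¹ / μ)) * PowerSeries.C (-μ)) * expSeries_mul_neg μ
    · rw [hq0, PowerSeries.smul_eq_C_mul]
      simp [constantCoeff_expSeries]
  right
  obtain ⟨c, hc⟩ : ∃ c : K, μ = b * -c := ⟨-(μ / b), by field_simp⟩
  have hv : v = powSeries b (-c) := by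
    refine eq_of_mul_derivative_eq (w := u) (μ := μ) hune (powSeries_mul_neg b (-c)) hμ ?_ ?_
    · rw [hu, neg_neg, one_add_mul_derivative_powSeries, hc, ← neg_mul, ← map_neg, mul_neg,
        neg_neg]
    · rw [hv0, constantCoeff_powSeries]
  by_cases hcz : c = 0
  · left
    have hv1 : v = 1 := by
      rw [hv, hcz, neg_zero, powSeries, PowerSeries.binomialSeries_zero, map_one]
    -- Antiderivative of `q' = p₀⁻¹ / (1 + bt)`.
    refine ⟨p0⁻¹ / b, b, div_ne_zero (inv_ne_zero hp0ne) hb, hb, ?_, hu, hv1⟩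
    refine series_ext (mul_left_cancel₀ hune ?_) ?_
    · rw [hv1, mul_one] at hq''
      rw [hq'', Derivation.map_smul, PowerSeries.smul_eq_C_mul, mul_left_comm, hu,
        one_add_mul_derivative_logSeries, ← map_mul, div_mul_cancel₀ _ hb]
    · rw [hq0, PowerSeries.smul_eq_C_mul]
      simp [constantCoeff_logSeries]
  · right
    -- Antiderivative of `q' = p₀⁻¹ (1 + bt)^(c-1)`.
    refine ⟨p0⁻¹ / (b * c), b, c, div_ne_zero (inv_ne_zero hp0ne) (mul_ne_zero hb hcz), hb, hcz,
      ?_, hu, hv⟩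
    refine series_ext (mul_left_cancel₀ (mul_ne_zero hune hvne) ?_) ?_
    · rw [hq'', Derivation.map_smul, map_sub, PowerSeries.derivative_one, sub_zero, hv,
        PowerSeries.smul_eq_C_mul]
      have e : (PowerSeries.C p0⁻¹ : K⟦X⟧) =
          PowerSeries.C (p0⁻¹ / (b * c)) * PowerSeries.C (b * c) := by
        rw [← map_mul, div_mul_cancel₀ _ (mul_ne_zero hb hcz)]
      have e2 := one_add_mul_derivative_powSeries b c
      rw [← hu] at e2
      rw [e]
      linear_combination (-PowerSeries.C (p0⁻¹ / (b * c)) * powSeries b (-c)) * e2 -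
        PowerSeries.C (p0⁻¹ / (b * c)) * PowerSeries.C (b * c) * powSeries_mul_neg b c
    · rw [hq0, PowerSeries.smul_eq_C_mul]
      simp [constantCoeff_powSeries]

end Series

/-! ### The table, in terms of operators -/

section Main

variable {K : Type*} [Field K]

theorem seriesHom_one_add (b : K) :
    seriesHom (1 + PowerSeries.C b * PowerSeries.X : K⟦X⟧) = 1 + b • D := by
  rw [map_add, map_mul, map_one, seriesHom_C, seriesHom_X, smul_mul_assoc, one_mul]

variable [CharZero K] {φ Q : Module.End K K[X]} {p q u v : K⟦X⟧}

theorem isDelta_D : IsDelta (D : Module.End K K[X]) :=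
  ⟨seriesHom_X (K := K) ▸ isShiftInvariant_seriesHom _, 1, one_ne_zero, by simp [D]⟩

/-- Together with `exists_series_of_isAppell`: Appell operators are the invertible operators
commuting with `D`, that is, the units among the series in `D`. -/
theorem isAppell_of_mul_eq_one (huv : u * v = 1) :
    ∃ A : (Module.End K K[X])ˣ, IsAppell (A : Module.End K K[X]) ∧
      seriesHom u = A ∧ seriesHom v = ↑A⁻¹ := by
  have h1 : seriesHom u * seriesHom v = 1 := by rw [← map_mul, huv, map_one]
  have h2 : seriesHom v * seriesHom u = 1 := by rw [seriesHom_comm, h1]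
  refine ⟨⟨seriesHom u, seriesHom v, h1, h2⟩, ⟨isDelta_D, Units.isUnit _, fun n => ?_⟩, rfl, rfl⟩
  change D (seriesHom u _) = n • seriesHom u _
  rw [← Module.End.mul_apply, ← seriesHom_commute_D, Module.End.mul_apply, D_X_pow, map_smul,
    Nat.cast_smul_eq_nsmul]

theorem exists_series_of_isAppell (A : (Module.End K K[X])ˣ)
    (hA : IsAppell (A : Module.End K K[X])) :
    ∃ u v : K⟦X⟧, u * v = 1 ∧ (A : Module.End K K[X]) = seriesHom u ∧
      (↑A⁻¹ : Module.End K K[X]) = seriesHom v := by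
  have h : Commute (A : Module.End K K[X]) D := hA.mul_eq.symm
  obtain ⟨u, hu⟩ := exists_seriesHom_of_commute_D h.eq
  obtain ⟨v, hv⟩ := exists_seriesHom_of_commute_D h.units_inv_left.eq
  refine ⟨u, v, seriesHom_injective ?_, hu, hv⟩
  rw [map_mul, ← hu, ← hv, Units.mul_inv, map_one]

theorem specialIdentity_X (hφ : IsUmbral φ Q) {a : K} (ha : a ≠ 0) (hQ : Q = a • D)
    (huv : u * v = 1) : SpecialIdentity φ (seriesHom u) (seriesHom v) := by
  refine hφ.specialIdentity_of_mul_eq_one (α := a⁻¹) (hφ.mul_mulX (q := a • PowerSeries.X) ?_ ?_)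
    huv
  · rw [hQ, map_smul, seriesHom_X]
  · rw [Derivation.map_smul, PowerSeries.derivative_X, PowerSeries.smul_eq_C_mul, mul_one,
      ← map_mul, inv_mul_cancel₀ ha, map_one]

theorem specialIdentity_exp (hφ : IsUmbral φ Q) {a b : K} (ha : a ≠ 0) (hb : b ≠ 0)
    (hQ : Q = a • (shift b - 1)) : SpecialIdentity φ 1 (shift (-b)) := by
  rw [← map_one seriesHom, shift_eq_seriesHom]
  -- The named argument `b := 0` is `u'` for `u = 1`; the shift parameter enters through `μ = -b`,
  -- since `v = exp(-bt)`.
  refine hφ.specialIdentity_of_series_eqs (hφ.mul_mulX (q := a • (expSeries b - 1)) ?_ ?_)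
    (α := (a * b)⁻¹) (b := 0) (μ := -b) rfl ?_ ?_ (map_one _) (constantCoeff_expSeries _)
  · rw [hQ, map_smul, map_sub, map_one, shift_eq_seriesHom, expSeries]
  · rw [← expSeries, Derivation.map_smul, map_sub, derivative_expSeries,
      PowerSeries.derivative_one, sub_zero, PowerSeries.smul_eq_C_mul]
    have h : (PowerSeries.C (a * b)⁻¹ * (PowerSeries.C a * PowerSeries.C b) : K⟦X⟧) = 1 := by
      rw [← map_mul, ← map_mul, inv_mul_cancel₀ (mul_ne_zero ha hb), map_one]
    linear_combination expSeries b * expSeries (-b) * h + expSeries_mul_neg b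
  · rw [PowerSeries.derivative_one, map_zero]
  · rw [one_mul]
    exact derivative_expSeries (-b)

theorem specialIdentity_log (hφ : IsUmbral φ Q) {a b : K} (ha : a ≠ 0) (hb : b ≠ 0)
    (hQ : Q = a • logOneAdd b) : SpecialIdentity φ (1 + b • D) 1 := by
  rw [← seriesHom_one_add, ← map_one seriesHom]
  refine hφ.specialIdentity_of_series_eqs (hφ.mul_mulX (q := a • logSeries b) ?_ ?_)
    (α := (a * b)⁻¹) (b := b) (μ := 0) rfl (derivative_one_add b) ?_ (constantCoeff_one_add b)
    (map_one _)
  · rw [hQ, map_smul]; rfl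
  · rw [Derivation.map_smul, PowerSeries.smul_eq_C_mul, mul_one]
    have h : (PowerSeries.C (a * b)⁻¹ * (PowerSeries.C a * PowerSeries.C b) : K⟦X⟧) = 1 := by
      rw [← map_mul, ← map_mul, inv_mul_cancel₀ (mul_ne_zero ha hb), map_one]
    linear_combination h + PowerSeries.C (a * b)⁻¹ * PowerSeries.C a *
      one_add_mul_derivative_logSeries b
  · rw [PowerSeries.derivative_one, map_zero, mul_zero, zero_mul]

theorem specialIdentity_pow (hφ : IsUmbral φ Q) {a b c : K} (ha : a ≠ 0) (hb : b ≠ 0) (hc : c ≠ 0)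
    (hQ : Q = a • (powOneAdd b c - 1)) : SpecialIdentity φ (1 + b • D) (powOneAdd b (-c)) := by
  rw [← seriesHom_one_add]
  refine hφ.specialIdentity_of_series_eqs (v := powSeries b (-c))
    (hφ.mul_mulX (q := a • (powSeries b c - 1)) ?_ ?_)
    (α := (a * (b * c))⁻¹) (b := b) (μ := b * -c) rfl (derivative_one_add b)
    (one_add_mul_derivative_powSeries b (-c)) (constantCoeff_one_add b) (constantCoeff_powSeries _ _)
  · rw [hQ, map_smul, map_sub, map_one]; rfl
  · rw [Derivation.map_smul, map_sub, PowerSeries.derivative_one, sub_zero,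
      PowerSeries.smul_eq_C_mul]
    have h : (PowerSeries.C (a * (b * c))⁻¹ * (PowerSeries.C a * PowerSeries.C (b * c)) : K⟦X⟧)
        = 1 := by
      rw [← map_mul, ← map_mul, inv_mul_cancel₀ (mul_ne_zero ha (mul_ne_zero hb hc)), map_one]
    linear_combination powSeries b c * powSeries b (-c) * h + powSeries_mul_neg b c +
      PowerSeries.C (a * (b * c))⁻¹ * PowerSeries.C a * powSeries b (-c) *
        one_add_mul_derivative_powSeries b c

theorem exists_series_of_isUmbral (hφ : IsUmbral φ Q) :
    ∃ q p : K⟦X⟧, Q = seriesHom q ∧ p * PowerSeries.derivative K q = 1 := by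
  obtain ⟨q, hQ⟩ := hφ.1.1.1.exists_seriesHom
  refine ⟨q, (PowerSeries.derivative K q)⁻¹, hQ, PowerSeries.inv_mul_cancel _ ?_⟩
  rw [← PowerSeries.coeff_zero_eq_constantCoeff_apply, PowerSeries.coeff_derivative]
  simpa using hφ.coeff_one_ne_zero hQ

theorem specialIdentity_iff_table (hφ : IsUmbral φ Q) (U V : Module.End K K[X]) :
    (IsShiftInvariant U ∧ IsShiftInvariant V ∧ SpecialIdentity φ U V) ↔
      (∃ a : K, a ≠ 0 ∧ Q = a • D ∧
        ∃ A : (Module.End K K[X])ˣ, IsAppell (A : Module.End K K[X]) ∧ U = A ∧ V = ↑A⁻¹) ∨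
      (∃ a b : K, a ≠ 0 ∧ b ≠ 0 ∧ Q = a • (shift b - 1) ∧ U = 1 ∧ V = shift (-b)) ∨
      (∃ a b : K, a ≠ 0 ∧ b ≠ 0 ∧ Q = a • logOneAdd b ∧ U = 1 + b • D ∧ V = 1) ∨
      (∃ a b c : K, a ≠ 0 ∧ b ≠ 0 ∧ c ≠ 0 ∧ Q = a • (powOneAdd b c - 1) ∧
        U = 1 + b • D ∧ V = powOneAdd b (-c)) := by
  constructor
  · rintro ⟨hU, hV, h⟩
    obtain ⟨u, rfl⟩ := hU.exists_seriesHom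
    obtain ⟨v, rfl⟩ := hV.exists_seriesHom
    obtain ⟨q, p, hQ, hp⟩ := exists_series_of_isUmbral hφ
    obtain ⟨h1, h2, h3⟩ := hφ.series_eqs_of_specialIdentity (hφ.mul_mulX hQ hp) h
    rcases series_classification (hφ.constantCoeff_eq_zero hQ) hp h1 h2 h3 with
      ⟨a, ha, hq, huv⟩ | ⟨a, b, ha, hb, hq, hu, hv⟩ | ⟨a, b, ha, hb, hq, hu, hv⟩ |
      ⟨a, b, c, ha, hb, hc, hq, hu, hv⟩
    · exact Or.inl ⟨a, ha, by rw [hQ, hq, map_smul, seriesHom_X], isAppell_of_mul_eq_one huv⟩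
    · refine Or.inr (Or.inl ⟨a, b, ha, hb, ?_, by rw [hu, map_one], ?_⟩)
      · rw [hQ, hq, map_smul, map_sub, map_one, shift_eq_seriesHom, expSeries]
      · rw [hv, shift_eq_seriesHom, expSeries]
    · refine Or.inr (Or.inr (Or.inl ⟨a, b, ha, hb, ?_, by rw [hu, seriesHom_one_add],
        by rw [hv, map_one]⟩))
      rw [hQ, hq, map_smul]; rfl
    · refine Or.inr (Or.inr (Or.inr ⟨a, b, c, ha, hb, hc, ?_, by rw [hu, seriesHom_one_add],
        by rw [hv]; rfl⟩))
      rw [hQ, hq, map_smul, map_sub, map_one]; rfl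
  · have h1 : IsShiftInvariant (1 : Module.End K K[X]) :=
      map_one (seriesHom (K := K)) ▸ isShiftInvariant_seriesHom 1
    have hb1 : ∀ b : K, IsShiftInvariant (1 + b • D : Module.End K K[X]) := fun b =>
      seriesHom_one_add b ▸ isShiftInvariant_seriesHom _
    rintro (⟨a, ha, hQ, A, hA, rfl, rfl⟩ | ⟨a, b, ha, hb, hQ, rfl, rfl⟩ |
      ⟨a, b, ha, hb, hQ, rfl, rfl⟩ | ⟨a, b, c, ha, hb, hc, hQ, rfl, rfl⟩)
    · obtain ⟨u, v, huv, hu, hv⟩ := exists_series_of_isAppell A hA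
      rw [hu, hv]
      exact ⟨isShiftInvariant_seriesHom u, isShiftInvariant_seriesHom v,
        specialIdentity_X hφ ha hQ huv⟩
    · exact ⟨h1, shift_eq_seriesHom (-b) ▸ isShiftInvariant_seriesHom _,
        specialIdentity_exp hφ ha hb hQ⟩
    · exact ⟨hb1 b, h1, specialIdentity_log hφ ha hb hQ⟩
    · exact ⟨hb1 b, isShiftInvariant_seriesHom (powSeries b (-c)),
        specialIdentity_pow hφ ha hb hc hQ⟩

end Main

end Umbral

end

open Umbral
theorem mainTheorem3 {K : Type*} [Field K] [CharZero K]
    (φ Q : Module.End K (Polynomial K)) (hφ : IsUmbral φ Q) :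
    ((∃ U V : Module.End K (Polynomial K),
        IsShiftInvariant U ∧ IsShiftInvariant V ∧ SpecialIdentity φ U V) ↔
      (∃ a : K, a ≠ 0 ∧ Q = a • D) ∨
      (∃ a b : K, a ≠ 0 ∧ b ≠ 0 ∧ Q = a • (shift b - 1)) ∨
      (∃ a b : K, a ≠ 0 ∧ b ≠ 0 ∧ Q = a • logOneAdd b) ∨
      (∃ a b c : K, a ≠ 0 ∧ b ≠ 0 ∧ c ≠ 0 ∧ Q = a • (powOneAdd b c - 1))) ∧
    (∀ U V : Module.End K (Polynomial K),
      (IsShiftInvariant U ∧ IsShiftInvariant V ∧ SpecialIdentity φ U V) ↔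
        (∃ a : K, a ≠ 0 ∧ Q = a • D ∧
          ∃ A : (Module.End K (Polynomial K))ˣ, IsAppell (A : Module.End K (Polynomial K)) ∧
            U = A ∧ V = ↑A⁻¹) ∨
        (∃ a b : K, a ≠ 0 ∧ b ≠ 0 ∧ Q = a • (shift b - 1) ∧
          U = 1 ∧ V = shift (-b)) ∨
        (∃ a b : K, a ≠ 0 ∧ b ≠ 0 ∧ Q = a • logOneAdd b ∧
          U = 1 + b • D ∧ V = 1) ∨
        (∃ a b c : K, a ≠ 0 ∧ b ≠ 0 ∧ c ≠ 0 ∧ Q = a • (powOneAdd b c - 1) ∧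
          U = 1 + b • D ∧ V = powOneAdd b (-c))) := by
  refine ⟨⟨?_, ?_⟩, specialIdentity_iff_table hφ⟩
  · rintro ⟨U, V, h⟩
    rcases (specialIdentity_iff_table hφ U V).1 h with ⟨a, ha, hQ, -⟩ | ⟨a, b, ha, hb, hQ, -⟩ |
      ⟨a, b, ha, hb, hQ, -⟩ | ⟨a, b, c, ha, hb, hc, hQ, -⟩
    · exact Or.inl ⟨a, ha, hQ⟩
    · exact Or.inr (Or.inl ⟨a, b, ha, hb, hQ⟩)
    · exact Or.inr (Or.inr (Or.inl ⟨a, b, ha, hb, hQ⟩))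
    · exact Or.inr (Or.inr (Or.inr ⟨a, b, c, ha, hb, hc, hQ⟩))
  · rintro (⟨a, ha, hQ⟩ | ⟨a, b, ha, hb, hQ⟩ | ⟨a, b, ha, hb, hQ⟩ | ⟨a, b, c, ha, hb, hc, hQ⟩)
    -- Any Appell operator will do as a witness; the choice `u = v = 1` supplies one.
    · obtain ⟨A, hA, -, -⟩ := isAppell_of_mul_eq_one (mul_one (1 : PowerSeries K))
      exact ⟨_, _, (specialIdentity_iff_table hφ _ _).2 (Or.inl ⟨a, ha, hQ, A, hA, rfl, rfl⟩)⟩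
    · exact ⟨_, _, (specialIdentity_iff_table hφ _ _).2
        (Or.inr (Or.inl ⟨a, b, ha, hb, hQ, rfl, rfl⟩))⟩
    · exact ⟨_, _, (specialIdentity_iff_table hφ _ _).2
        (Or.inr (Or.inr (Or.inl ⟨a, b, ha, hb, hQ, rfl, rfl⟩)))⟩
    · exact ⟨_, _, (specialIdentity_iff_table hφ _ _).2
        (Or.inr (Or.inr (Or.inr ⟨a, b, c, ha, hb, hc, hQ, rfl, rfl⟩)))⟩
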